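/- **Theorem (Geodesics I).** Let $0\le k\le n$ be integers and let $$\mathrm{Gr}(k,n)=\{Q\in\mathrm{O}(n): Q^{\mathsf T}=Q,\ \operatorname{tr}(Q)=2k-n\}$$ be the involution model of the Grassmannian, a submanifold of $\mathrm{O}(n)$ equipped with the Riemannian metric $\langle X,Y\rangle_Q=\operatorname{tr}(X^{\mathsf T}Y)=\operatorname{tr}(XY)$ on its (symmetric) tangent vectors. A *geodesic* on an open interval $I$ is a $C^2$ curve $c:I\to\mathrm{Gr}(k,n)$ of constant speed which, unless it is constant, is a critical point of the length functional $L(c)=\int_a^b\lVert\dot c(t)\rVert_{c(t)}\,dt$ for every $[a,b]\subseteq I$ with $a<b$, with respect to $C^2$ variations of $c|_{[a,b]}$ in $\mathrm{Gr}(k,n)$ with fixed end points. Let $I_{k,n-k}=\operatorname{diag}(I_k,-I_{n-k})$, $V\in\mathrm{O}(n)$, $B\in\mathbb R^{k\times(n-k)}$ and $$Q=V I_{k,n-k}V^{\mathsf T},\qquad X=V\begin{bmatrix}0&B\\B^{\mathsf T}&0\end{bmatrix}V^{\mathsf T}.$$ Define, for $t\in\mathbb R$, $$\gamma(t)=V\exp\left(\frac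 t2\begin{bmatrix}0&-B\\B^{\mathsf T}&0\end{bmatrix}\right)I_{k,n-k}\exp\left(\frac t2\begin{bmatrix}0&B\\-B^{\mathsf T}&0\end{bmatrix}\right)V^{\mathsf T}.$$ Then: 1. $\gamma$ is smooth and is a geodesic of $\mathrm{Gr}(k,n)$ on $\mathbb R$, with $\gamma(0)=Q$ and $\dot\gamma(0)=X$. 2. $\gamma$ is the only such geodesic: every geodesic $c$ on an open interval $I\ni0$ with $c(0)=Q$ and $\dot c(0)=X$ equals $\gamma|_I$. 3. $\gamma$ satisfies $\gamma(t)^{\mathsf T}\ddot\gamma(t)-\ddot\gamma(t)^{\mathsf T}\gamma(t)=0$ for all $t\in\mathbb R$. 4. This is the differential equation of the geodesic: a $C^2$ curve $c:I\to\mathrm{Gr}(k,n)$ on an open interval $I\ni 0$ with $c(0)=Q$ and $\dot c(0)=X$ is a geodesic if and only if $c(t)^{\mathsf T}\ddot c(t)-\ddot c(t)^{\mathsf T}c(t)=0$ for all $t\in I$. -/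

import Mathlib

open Set Matrix
open scoped ContDiff

namespace Involution

/-- Real `n × n` matrices. -/
abbrev Mat (n : ℕ) := Matrix (Fin n) (Fin n) ℝ

end Involution

-- Real matrices carry the Frobenius norm, so that derivatives of matrix curves make sense.
attribute [local instance] Matrix.frobeniusNormedRing Matrix.frobeniusNormedAlgebra

noncomputable section

namespace Involution

/-- The `n × n` matrix with blocks `[[A, B], [C, D]]`, where `A` is `k × k`, `B` is `k × (n - k)`,
`C` is `(n - k) × k` and `D` is `(n - k) × (n - k)`. -/
def block {k n : ℕ} (hk : k ≤ n)
    (A : Matrix (Fin k) (Fin k) ℝ) (B : Matrix (Fin k) (Fin (n - k)) ℝ)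
    (C : Matrix (Fin (n - k)) (Fin k) ℝ) (D : Matrix (Fin (n - k)) (Fin (n - k)) ℝ) : Mat n :=
  let e : Fin k ⊕ Fin (n - k) ≃ Fin n :=
    finSumFinEquiv.trans (finCongr (Nat.add_sub_of_le hk))
  Matrix.reindex e e (Matrix.fromBlocks A B C D)

/-- `I_{k,n-k} = diag(I_k, -I_{n-k})`. -/
def signature {k n : ℕ} (hk : k ≤ n) : Mat n := block hk 1 0 0 (-1)

/-- The involution model of the Grassmannian: symmetric orthogonal `n × n` matrices of
trace `2k - n`. -/
def Gr (k n : ℕ) : Set (Mat n) :=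
  {Q | Q ∈ Matrix.orthogonalGroup (Fin n) ℝ ∧ Qᵀ = Q ∧ Q.trace = 2 * (k : ℝ) - (n : ℝ)}

/-- The bi-invariant Riemannian metric `tr(XᵀY)` of `O(n)`, restricted to the Grassmannian.
Tangent vectors of the Grassmannian are symmetric matrices, for which it is `tr(XY)`. -/
def metric {n : ℕ} (X Y : Mat n) : ℝ := (Xᵀ * Y).trace

/-- The Riemannian norm of a tangent vector. -/
def riemNorm {n : ℕ} (X : Mat n) : ℝ := Real.sqrt (metric X X)

/-- The length functional on curves with parameter interval `[a, b]`. -/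
def curveLength {n : ℕ} (c : ℝ → Mat n) (a b : ℝ) : ℝ :=
  ∫ t in a..b, riemNorm (deriv c t)

/-- `F ε`, for `|ε| < δ`, is a `C²` variation in the Grassmannian, with fixed end points, of the
curve `c` on `[a, b]`. (Being `C²` on a rectangle closed in the `t`-direction means, as usual,
being so on an open neighbourhood of it.) -/
structure IsProperVariation (k : ℕ) {n : ℕ} (c : ℝ → Mat n) (a b δ : ℝ)
    (F : ℝ → ℝ → Mat n) : Prop where
  contDiffOn : ContDiffOn ℝ 2 (fun p : ℝ × ℝ => F p.1 p.2) (Ioo (-δ) δ ×ˢ Ioo (a - δ) (b + δ))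
  mem : ∀ ε ∈ Ioo (-δ) δ, ∀ t ∈ Icc a b, F ε t ∈ Gr k n
  zero : ∀ t ∈ Icc a b, F 0 t = c t
  left : ∀ ε ∈ Ioo (-δ) δ, F ε a = c a
  right : ∀ ε ∈ Ioo (-δ) δ, F ε b = c b

/-- A geodesic of the Grassmannian, parametrized by the open interval `I`: a `C²` curve of constant
speed `K` which, unless it is a constant curve (`K = 0`), is a critical point of the length
functional on every compact subinterval, with respect to variations with fixed end points. -/
structure IsGeodesicOn (k : ℕ) {n : ℕ} (I : Set ℝ) (c : ℝ → Mat n) : Prop where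
  contDiffOn : ContDiffOn ℝ 2 c I
  mem : ∀ t ∈ I, c t ∈ Gr k n
  constSpeed_critical : ∃ K : ℝ, (∀ t ∈ I, riemNorm (deriv c t) = K) ∧
    (K ≠ 0 → ∀ a b : ℝ, a < b → Icc a b ⊆ I →
      ∀ δ > 0, ∀ F : ℝ → ℝ → Mat n, IsProperVariation k c a b δ F →
        HasDerivAt (fun ε => curveLength (F ε) a b) 0 0)

/-- The curve
`γ(t) = V exp((t/2) [[0, -B], [Bᵀ, 0]]) I_{k,n-k} exp((t/2) [[0, B], [-Bᵀ, 0]]) Vᵀ`. -/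
def geodesicCurve {k n : ℕ} (hk : k ≤ n) (V : Mat n) (B : Matrix (Fin k) (Fin (n - k)) ℝ)
    (t : ℝ) : Mat n :=
  V * NormedSpace.exp ((t / 2) • block hk 0 (-B) Bᵀ 0) * signature hk *
    NormedSpace.exp ((t / 2) • block hk 0 B (-Bᵀ) 0) * Vᵀ

end Involution

end

/-! ### Calculus for maps of two real variables -/

open Filter Topology

/-! For a curve of constant speed `K ≠ 0`, the first variation of length is `-K⁻¹ ∫ ⟨c̈, W⟩`, with
`W` the variation field (`IsProperVariation.hasDerivAt_curveLength`). Tangent vectors at `Q` satisfy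
`QW + WQ = 0`, and a symmetric matrix commuting with `Q` is orthogonal to all of them. Since `c` and
`c̈` are symmetric, the equation says that `c̈` commutes with `c`, so `c̈` is normal: speed is
constant and the first variation vanishes (`isGeodesicOn_of_equation`). Conversely, varying a
geodesic by rotations `exp(εφS) c exp(-εφS)`, with `S` skew, forces the commutator `[c, c̈]` to
vanish (`equation_of_isGeodesicOn`).

For uniqueness, differentiating `c² = 1` twice and using commutation gives `ċ² + c c̈ = 0`. So `c ċ`
is constant, equal to `QX`, and `ċ = c (QX)` is a linear equation with one solution starting at `Q`.
The explicit curve solves it, hence also the second-order equation. -/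

theorem hasDerivAt_intervalIntegral_of_contDiffOn {G : ℝ × ℝ → ℝ} {U : Set (ℝ × ℝ)}
    (hU : IsOpen U) (hG : ContDiffOn ℝ 1 G U) {a b : ℝ} (hab : a ≤ b)
    (h0 : ∀ t ∈ Icc a b, ((0 : ℝ), t) ∈ U) :
    HasDerivAt (fun ε => ∫ t in a..b, G (ε, t)) (∫ t in a..b, fderiv ℝ G (0, t) (1, 0)) 0 := by
  -- The tube lemma gives one range of `ε` for all `t`; compactness of the resulting rectangle then
  -- supplies a constant dominating function.
  obtain ⟨u, v, hu, -, hu0, hv, huv⟩ := generalized_tube_lemma (s := {(0 : ℝ)}) (t := Icc a b)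
    isCompact_singleton isCompact_Icc hU (by
      rintro ⟨x, t⟩ ⟨hx, ht⟩
      obtain rfl : x = 0 := hx
      exact h0 t ht)
  obtain ⟨η, hη, hηu⟩ := Metric.isOpen_iff.1 hu 0 (hu0 rfl)
  have hsub : Metric.closedBall (0 : ℝ) (η / 2) ×ˢ Icc a b ⊆ U := fun p hp =>
    huv ⟨hηu (Metric.closedBall_subset_ball (by linarith) hp.1), hv hp.2⟩
  have hfd : ContinuousOn (fun p => fderiv ℝ G p (1, 0)) U :=
    (hG.continuousOn_fderiv_of_isOpen hU le_rfl).clm_apply continuousOn_const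
  obtain ⟨C, hC⟩ := ((isCompact_closedBall (0 : ℝ) (η / 2)).prod isCompact_Icc)
    |>.exists_bound_of_continuousOn (hfd.mono hsub)
  have hsl : ∀ {E : Type} [TopologicalSpace E] {f : ℝ × ℝ → E}, ContinuousOn f U →
      ∀ x ∈ Metric.closedBall (0 : ℝ) (η / 2), ContinuousOn (fun t => f (x, t)) (uIcc a b) := by
    intro E _ f hf x hx
    rw [uIcc_of_le hab]
    exact hf.comp (by fun_prop) fun t ht => hsub ⟨hx, ht⟩
  have hmem0 : (0 : ℝ) ∈ Metric.closedBall (0 : ℝ) (η / 2) :=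
    Metric.mem_closedBall_self (by linarith)
  have hball : Metric.ball (0 : ℝ) (η / 2) ∈ 𝓝 (0 : ℝ) := Metric.ball_mem_nhds _ (by linarith)
  refine (intervalIntegral.hasDerivAt_integral_of_dominated_loc_of_deriv_le
    (F := fun ε t => G (ε, t)) (F' := fun ε t => fderiv ℝ G (ε, t) (1, 0))
    (bound := fun _ => C) hball ?_ ?_ ?_ ?_ ?_ ?_).2
  · filter_upwards [hball] with x hx
    have := (hsl hG.continuousOn x (Metric.ball_subset_closedBall hx)).intervalIntegrable
      (μ := MeasureTheory.volume)
    exact (intervalIntegrable_iff.1 this).aestronglyMeasurable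
  · exact (hsl hG.continuousOn 0 hmem0).intervalIntegrable
  · exact (intervalIntegrable_iff.1 (hsl hfd 0 hmem0).intervalIntegrable).aestronglyMeasurable
  · refine Eventually.of_forall fun t ht x hx => hC (x, t) ⟨Metric.ball_subset_closedBall hx, ?_⟩
    rw [uIoc_of_le hab] at ht
    exact Ioc_subset_Icc_self ht
  · exact intervalIntegrable_const
  · refine Eventually.of_forall fun t ht x hx => ?_
    rw [uIoc_of_le hab] at ht
    have hp : (x, t) ∈ U := hsub ⟨Metric.ball_subset_closedBall hx, Ioc_subset_Icc_self ht⟩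
    have hd : HasFDerivAt G (fderiv ℝ G (x, t)) (x, t) :=
      ((hG.contDiffAt (hU.mem_nhds hp)).differentiableAt (by norm_num)).hasFDerivAt
    exact hd.comp_hasDerivAt x ((hasDerivAt_id x).prodMk (hasDerivAt_const x t))

/-- The first and mixed second partial derivatives of a `C²` map of two real variables. -/
theorem exists_partial_derivs_of_contDiffOn {E : Type*} [NormedAddCommGroup E] [NormedSpace ℝ E]
    {Φ : ℝ × ℝ → E} {R : Set (ℝ × ℝ)} (hR : IsOpen R) (hΦ : ContDiffOn ℝ 2 Φ R) :
    ∃ D₁ D₂ D₁₂ : ℝ × ℝ → E, ContDiffOn ℝ 1 D₂ R ∧ ContinuousOn D₁₂ R ∧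
      ∀ ε t, (ε, t) ∈ R →
        HasDerivAt (fun x => Φ (x, t)) (D₁ (ε, t)) ε ∧
        HasDerivAt (fun s => Φ (ε, s)) (D₂ (ε, t)) t ∧
        HasDerivAt (fun x => D₂ (x, t)) (D₁₂ (ε, t)) ε ∧
        HasDerivAt (fun s => D₁ (ε, s)) (D₁₂ (ε, t)) t := by
  have hdΦ : ContDiffOn ℝ 1 (fderiv ℝ Φ) R := hΦ.fderiv_of_isOpen hR (by norm_num)
  have hfst : ∀ ε t : ℝ, HasDerivAt (fun x : ℝ => (x, t)) ((1 : ℝ), (0 : ℝ)) ε := fun ε t =>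
    (hasDerivAt_id ε).prodMk (hasDerivAt_const ε t)
  have hsnd : ∀ ε t : ℝ, HasDerivAt (fun s : ℝ => (ε, s)) ((0 : ℝ), (1 : ℝ)) t := fun ε t =>
    (hasDerivAt_const t ε).prodMk (hasDerivAt_id t)
  refine ⟨fun p => fderiv ℝ Φ p (1, 0), fun p => fderiv ℝ Φ p (0, 1),
    fun p => fderiv ℝ (fderiv ℝ Φ) p (0, 1) (1, 0), hdΦ.clm_apply contDiffOn_const,
    ((hdΦ.continuousOn_fderiv_of_isOpen hR le_rfl).clm_apply continuousOn_const).clm_apply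
      continuousOn_const, fun ε t hp => ?_⟩
  have h1 : HasFDerivAt Φ (fderiv ℝ Φ (ε, t)) (ε, t) :=
    ((hΦ.contDiffAt (hR.mem_nhds hp)).differentiableAt (by norm_num)).hasFDerivAt
  have h2 : HasFDerivAt (fderiv ℝ Φ) (fderiv ℝ (fderiv ℝ Φ) (ε, t)) (ε, t) :=
    ((hdΦ.contDiffAt (hR.mem_nhds hp)).differentiableAt (by norm_num)).hasFDerivAt
  have hs : IsSymmSndFDerivAt ℝ Φ (ε, t) :=
    (hΦ.contDiffAt (hR.mem_nhds hp)).isSymmSndFDerivAt (by simp)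
  have h3 : HasDerivAt (fun x => fderiv ℝ Φ (x, t)) (fderiv ℝ (fderiv ℝ Φ) (ε, t) (1, 0)) ε :=
    h2.comp_hasDerivAt ε (hfst ε t)
  have h4 : HasDerivAt (fun s => fderiv ℝ Φ (ε, s)) (fderiv ℝ (fderiv ℝ Φ) (ε, t) (0, 1)) t :=
    h2.comp_hasDerivAt t (hsnd ε t)
  refine ⟨h1.comp_hasDerivAt ε (hfst ε t), h1.comp_hasDerivAt t (hsnd ε t), ?_, ?_⟩
  -- `D₁₂` is by definition the `t`-derivative of `D₁`; symmetry of the second derivative makes it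
  -- the `ε`-derivative of `D₂` too.
  · have h := (ContinuousLinearMap.apply ℝ E ((0 : ℝ), (1 : ℝ))).hasFDerivAt.comp_hasDerivAt ε h3
    exact h.congr_deriv (hs.eq _ _)
  · exact (ContinuousLinearMap.apply ℝ E ((1 : ℝ), (0 : ℝ))).hasFDerivAt.comp_hasDerivAt t h4

/-! ### The trace metric and the first variation of length -/

namespace Involution

variable {n : ℕ}

/-- The trace as a continuous linear functional. -/
noncomputable def traceCLM (n : ℕ) : Mat n →L[ℝ] ℝ :=
  LinearMap.toContinuousLinearMap (Matrix.traceLinearMap (Fin n) ℝ ℝ)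

/-- The transpose as a continuous linear map. -/
noncomputable def transposeCLM (n : ℕ) : Mat n →L[ℝ] Mat n :=
  LinearMap.toContinuousLinearMap
    ((Matrix.transposeLinearEquiv (Fin n) (Fin n) ℝ ℝ : Mat n ≃ₗ[ℝ] Mat n) : Mat n →ₗ[ℝ] Mat n)

theorem metric_comm (X Y : Mat n) : metric X Y = metric Y X := by
  rw [metric, ← Matrix.trace_transpose, Matrix.transpose_mul, Matrix.transpose_transpose, metric]

theorem metric_self_eq_sum (X : Mat n) : metric X X = ∑ i, ∑ j, X j i * X j i := by
  simp [metric, Matrix.trace, Matrix.mul_apply]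

theorem metric_self_nonneg (X : Mat n) : 0 ≤ metric X X := by
  rw [metric_self_eq_sum]
  exact Finset.sum_nonneg fun i _ => Finset.sum_nonneg fun j _ => mul_self_nonneg _

theorem metric_self_eq_zero {X : Mat n} : metric X X = 0 ↔ X = 0 := by
  refine ⟨fun h => ?_, fun h => by simp [h, metric]⟩
  rw [metric_self_eq_sum, Finset.sum_eq_zero_iff_of_nonneg
    fun i _ => Finset.sum_nonneg fun j _ => mul_self_nonneg _] at h
  ext i j
  have := (Finset.sum_eq_zero_iff_of_nonneg fun j _ => mul_self_nonneg _).1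
    (h j (Finset.mem_univ _)) i (Finset.mem_univ _)
  simpa using this

theorem riemNorm_eq_zero {X : Mat n} : riemNorm X = 0 ↔ X = 0 := by
  rw [riemNorm, Real.sqrt_eq_zero (metric_self_nonneg X), metric_self_eq_zero]

theorem HasDerivAt.matrix_transpose {f : ℝ → Mat n} {f' : Mat n} {t : ℝ}
    (hf : HasDerivAt f f' t) : HasDerivAt (fun s => (f s)ᵀ) f'ᵀ t :=
  (transposeCLM n).hasFDerivAt.comp_hasDerivAt t hf

theorem HasDerivAt.metric {f g : ℝ → Mat n} {f' g' : Mat n} {t : ℝ}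
    (hf : HasDerivAt f f' t) (hg : HasDerivAt g g' t) :
    HasDerivAt (fun s => metric (f s) (g s)) (metric f' (g t) + metric (f t) g') t := by
  have h := (traceCLM n).hasFDerivAt.comp_hasDerivAt t ((HasDerivAt.matrix_transpose hf).mul hg)
  exact h.congr_deriv ((traceCLM n).map_add _ _)

theorem ContDiffOn.metric {E : Type*} [NormedAddCommGroup E] [NormedSpace ℝ E]
    {f g : E → Mat n} {s : Set E} {m : WithTop ℕ∞} (hf : ContDiffOn ℝ m f s)
    (hg : ContDiffOn ℝ m g s) : ContDiffOn ℝ m (fun x => metric (f x) (g x)) s :=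
  (traceCLM n).contDiff.comp_contDiffOn (((transposeCLM n).contDiff.comp_contDiffOn hf).mul hg)

theorem ContinuousOn.metric {E : Type*} [TopologicalSpace E]
    {f g : E → Mat n} {s : Set E} (hf : ContinuousOn f s) (hg : ContinuousOn g s) :
    ContinuousOn (fun x => metric (f x) (g x)) s :=
  (traceCLM n).continuous.comp_continuousOn
    (((transposeCLM n).continuous.comp_continuousOn hf).mul hg)

theorem hasDerivAt_deriv_of_contDiffOn
    {I : Set ℝ} (hI : IsOpen I) {c : ℝ → Mat n} (hc : ContDiffOn ℝ 2 c I) {t : ℝ} (ht : t ∈ I) :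
    HasDerivAt c (deriv c t) t ∧ HasDerivAt (deriv c) (deriv (deriv c) t) t := by
  have h1 : ContDiffOn ℝ 1 (deriv c) I := hc.deriv_of_isOpen hI (by norm_num)
  exact ⟨((hc.contDiffAt (hI.mem_nhds ht)).differentiableAt (by norm_num)).hasDerivAt,
    ((h1.contDiffAt (hI.mem_nhds ht)).differentiableAt (by norm_num)).hasDerivAt⟩

theorem continuousOn_deriv_deriv
    {I : Set ℝ} (hI : IsOpen I) {c : ℝ → Mat n} (hc : ContDiffOn ℝ 2 c I) :
    ContinuousOn (deriv (deriv c)) I :=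
  (hc.deriv_of_isOpen (m := 1) hI (by norm_num)).continuousOn_deriv_of_isOpen hI le_rfl

/-- The first variation of the length of a curve of constant non-zero speed. -/
theorem IsProperVariation.hasDerivAt_curveLength {k : ℕ} {I : Set ℝ} (hI : IsOpen I)
    {c : ℝ → Mat n} (hc : ContDiffOn ℝ 2 c I) {K : ℝ} (hK : K ≠ 0)
    (hspeed : ∀ t ∈ I, riemNorm (deriv c t) = K) {a b δ : ℝ} (hab : a < b) (hsub : Icc a b ⊆ I)
    (hδ : 0 < δ) {F : ℝ → ℝ → Mat n} (hF : IsProperVariation k c a b δ F) :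
    HasDerivAt (fun ε => curveLength (F ε) a b)
      (-K⁻¹ * ∫ t in a..b, metric (deriv (deriv c) t) (deriv (fun ε => F ε t) 0)) 0 := by
  set R : Set (ℝ × ℝ) := Ioo (-δ) δ ×ˢ Ioo (a - δ) (b + δ) with hR
  have hRo : IsOpen R := isOpen_Ioo.prod isOpen_Ioo
  obtain ⟨D₁, D₂, D₁₂, hD₂c, hD₁₂c, hder⟩ :=
    exists_partial_derivs_of_contDiffOn hRo hF.contDiffOn
  have hR0 : ∀ t ∈ Icc a b, ((0 : ℝ), t) ∈ R := fun t ht =>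
    ⟨⟨by linarith, hδ⟩, ⟨by linarith [ht.1], by linarith [ht.2]⟩⟩
  -- `F 0` agrees with `c` only on `[a, b]`, so at the end points the comparison needs derivatives
  -- within the interval.
  have hvel : ∀ t ∈ Icc a b, D₂ (0, t) = deriv c t := fun t ht => by
    have h1 := (hder 0 t (hR0 t ht)).2.1.hasDerivWithinAt (s := Icc a b)
    have h2 := (hasDerivAt_deriv_of_contDiffOn hI hc (hsub ht)).1.hasDerivWithinAt (s := Icc a b)
    exact (uniqueDiffOn_Icc hab t ht).eq_deriv _ (h1.congr (fun s hs => (hF.zero s hs).symm)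
      (hF.zero t ht).symm) h2
  set W : ℝ → Mat n := fun t => D₁ (0, t) with hW
  set W' : ℝ → Mat n := fun t => D₁₂ (0, t) with hW'
  have hWd : ∀ t ∈ Icc a b, HasDerivAt W (W' t) t := fun t ht => (hder 0 t (hR0 t ht)).2.2.2
  have hW'c : ContinuousOn W' (Icc a b) := hD₁₂c.comp (by fun_prop) hR0
  have hWeq : ∀ t ∈ Icc a b, deriv (fun ε => F ε t) 0 = W t := fun t ht =>
    (hder 0 t (hR0 t ht)).1.deriv
  have hWend : ∀ t ∈ Icc a b, (∀ ε ∈ Ioo (-δ) δ, F ε t = c t) → W t = 0 := fun t ht h => by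
    have : (fun ε => F ε t) =ᶠ[𝓝 0] fun _ => c t := by
      filter_upwards [Ioo_mem_nhds (neg_lt_zero.2 hδ) hδ] with ε hε using h ε hε
    exact (hWeq t ht).symm.trans (this.deriv_eq.trans (deriv_const 0 (c t)))
  set m : ℝ × ℝ → ℝ := fun p => metric (D₂ p) (D₂ p) with hm
  have hmc : ContDiffOn ℝ 1 m R := ContDiffOn.metric hD₂c hD₂c
  -- The square root is smooth only away from zero speed; `K ≠ 0` keeps the segment `ε = 0` inside
  -- `U`.
  set U : Set (ℝ × ℝ) := R ∩ m ⁻¹' {0}ᶜ with hU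
  have hUo : IsOpen U := hmc.continuousOn.isOpen_inter_preimage hRo isOpen_compl_singleton
  have hG : ContDiffOn ℝ 1 (fun p => Real.sqrt (m p)) U :=
    (hmc.mono inter_subset_left).sqrt fun p hp => hp.2
  have hmK : ∀ t ∈ Icc a b, Real.sqrt (m (0, t)) = K := fun t ht => by
    simp only [hm, hvel t ht]
    exact hspeed t (hsub ht)
  have hU0 : ∀ t ∈ Icc a b, ((0 : ℝ), t) ∈ U := fun t ht =>
    ⟨hR0 t ht, fun h0 => hK (by rw [← hmK t ht, show m (0, t) = 0 from h0, Real.sqrt_zero])⟩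
  have hmain := hasDerivAt_intervalIntegral_of_contDiffOn hUo hG hab.le hU0
  have hlen : (fun ε => curveLength (F ε) a b) =ᶠ[𝓝 0]
      fun ε => ∫ t in a..b, Real.sqrt (m (ε, t)) := by
    filter_upwards [Ioo_mem_nhds (neg_lt_zero.2 hδ) hδ] with ε hε
    refine intervalIntegral.integral_congr fun t ht => ?_
    rw [uIcc_of_le hab.le] at ht
    have hp : (ε, t) ∈ R := ⟨hε, ⟨by linarith [ht.1], by linarith [ht.2]⟩⟩
    have hd : deriv (F ε) t = D₂ (ε, t) := (hder ε t hp).2.1.deriv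
    simp only [riemNorm, hm, hd]
  have hint : ∀ t ∈ Icc a b, fderiv ℝ (fun p => Real.sqrt (m p)) (0, t) (1, 0) =
      K⁻¹ * metric (deriv c t) (W' t) := fun t ht => by
    have hd := ((hG.contDiffAt (hUo.mem_nhds (hU0 t ht))).differentiableAt
      (by norm_num)).hasFDerivAt.comp_hasDerivAt (0 : ℝ)
        ((hasDerivAt_id (0 : ℝ)).prodMk (hasDerivAt_const (0 : ℝ) t))
    have hD : HasDerivAt (fun ε : ℝ => D₂ (ε, t)) (W' t) 0 := (hder 0 t (hR0 t ht)).2.2.1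
    have he := (HasDerivAt.metric hD hD).sqrt (hU0 t ht).2
    have := hd.unique he
    refine this.trans ?_
    have hK' : Real.sqrt (metric (D₂ (0, t)) (D₂ (0, t))) = K := hmK t ht
    rw [hK', metric_comm (W' t), hvel t ht]
    field_simp
    ring
  -- Integration by parts: the integrand is the derivative of `⟨ċ, W⟩`, and `W` vanishes at both
  -- ends.
  have hparts :
      ∫ t in a..b, (metric (deriv (deriv c) t) (W t) + metric (deriv c t) (W' t)) = 0 := by
    rw [intervalIntegral.integral_eq_sub_of_hasDerivAt (f := fun t => metric (deriv c t) (W t))]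
    · rw [hWend a (left_mem_Icc.2 hab.le) hF.left, hWend b (right_mem_Icc.2 hab.le) hF.right]
      simp [metric]
    · intro t ht
      rw [uIcc_of_le hab.le] at ht
      exact HasDerivAt.metric (hasDerivAt_deriv_of_contDiffOn hI hc (hsub ht)).2 (hWd t ht)
    · refine ContinuousOn.intervalIntegrable ?_
      rw [uIcc_of_le hab.le]
      exact (ContinuousOn.metric ((continuousOn_deriv_deriv hI hc).mono hsub)
        (fun t ht => (hWd t ht).continuousAt.continuousWithinAt)).add
        (ContinuousOn.metric (fun t ht => (hasDerivAt_deriv_of_contDiffOn hI hc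
          (hsub ht)).2.continuousAt.continuousWithinAt) hW'c)
  have hi1 : IntervalIntegrable (fun t => metric (deriv (deriv c) t) (W t))
      MeasureTheory.volume a b := by
    refine ContinuousOn.intervalIntegrable ?_
    rw [uIcc_of_le hab.le]
    exact ContinuousOn.metric ((continuousOn_deriv_deriv hI hc).mono hsub)
      (fun t ht => (hWd t ht).continuousAt.continuousWithinAt)
  have hi2 : IntervalIntegrable (fun t => metric (deriv c t) (W' t))
      MeasureTheory.volume a b := by
    refine ContinuousOn.intervalIntegrable ?_
    rw [uIcc_of_le hab.le]
    exact ContinuousOn.metric (fun t ht => (hasDerivAt_deriv_of_contDiffOn hI hc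
          (hsub ht)).2.continuousAt.continuousWithinAt) hW'c
  rw [intervalIntegral.integral_add hi1 hi2] at hparts
  refine (hmain.congr_of_eventuallyEq hlen).congr_deriv ?_
  rw [intervalIntegral.integral_congr (g := fun t => K⁻¹ * metric (deriv c t) (W' t))
      (fun t ht => hint t (by rwa [uIcc_of_le hab.le] at ht)),
    intervalIntegral.integral_congr (f := fun t => metric (deriv (deriv c) t) _)
      (g := fun t => metric (deriv (deriv c) t) (W t))
      (fun t ht => by simp only [hWeq t (by rwa [uIcc_of_le hab.le] at ht)]),
    intervalIntegral.integral_const_mul]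
  linear_combination K⁻¹ * hparts

/-! ### Tangent and normal vectors of the Grassmannian -/

variable {k : ℕ}

theorem Gr.transpose_eq {Q : Mat n} (h : Q ∈ Gr k n) : Qᵀ = Q := h.2.1

theorem Gr.mul_self {Q : Mat n} (h : Q ∈ Gr k n) : Q * Q = 1 := by
  have h1 := (Matrix.mem_orthogonalGroup_iff (Fin n) ℝ).1 h.1
  rwa [h.2.1] at h1

theorem Gr.of_mul_self {Q : Mat n} (h1 : Q * Q = 1) (h2 : Qᵀ = Q)
    (h3 : Q.trace = 2 * (k : ℝ) - n) : Q ∈ Gr k n := by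
  refine ⟨(Matrix.mem_orthogonalGroup_iff (Fin n) ℝ).2 ?_, h2, h3⟩
  rw [h2, h1]

/-- The Grassmannian is invariant under orthogonal conjugation. -/
theorem Gr.conj {U Q : Mat n} (hU : Uᵀ * U = 1) (hQ : Q ∈ Gr k n) : U * Q * Uᵀ ∈ Gr k n := by
  refine Gr.of_mul_self ?_ ?_ ?_
  · calc U * Q * Uᵀ * (U * Q * Uᵀ) = U * Q * (Uᵀ * U) * Q * Uᵀ := by noncomm_ring
      _ = U * (Q * Q) * Uᵀ := by rw [hU]; noncomm_ring
      _ = 1 := by rw [Gr.mul_self hQ, mul_one, mul_eq_one_comm.1 hU]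
  · simp [Matrix.transpose_mul, Gr.transpose_eq hQ, mul_assoc]
  · rw [Matrix.trace_mul_comm, ← mul_assoc, hU, one_mul, hQ.2.2]

/-- Normal vectors are orthogonal to tangent vectors. -/
theorem metric_eq_zero_of_commute {Q A W : Mat n} (hQ : Q * Q = 1) (hA : Aᵀ = A)
    (hQA : Q * A = A * Q) (hW : Q * W + W * Q = 0) : metric A W = 0 := by
  have h1 : W = -(Q * W * Q) := by
    have h2 : Q * (Q * W + W * Q) = 0 := by rw [hW, mul_zero]
    rw [mul_add, ← mul_assoc, hQ, one_mul, ← mul_assoc] at h2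
    exact eq_neg_of_add_eq_zero_left h2
  -- Conjugation by `Q` fixes `A`, negates `W` and preserves the trace.
  have h3 : (A * W).trace = -(A * W).trace := by
    calc (A * W).trace = -(A * Q * W * Q).trace := by
          conv_lhs => rw [h1]
          rw [mul_neg, Matrix.trace_neg]; simp only [mul_assoc]
      _ = -(Q * (A * Q * W)).trace := by rw [Matrix.trace_mul_comm Q]
      _ = -(Q * Q * A * W).trace := by rw [← hQA]; simp only [mul_assoc]
      _ = -(A * W).trace := by rw [hQ, one_mul]
  rw [metric, hA]
  linarith

/-- Cyclicity of the trace. It turns the pairing of `c̈` with a rotation field `[S, c]` into a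
pairing of `S` with `[c, c̈]`. -/
theorem trace_mul_commutator (A S Q : Mat n) :
    (A * (S * Q - Q * S)).trace = (S * (Q * A - A * Q)).trace := by
  have h1 : (A * (S * Q)).trace = (S * (Q * A)).trace := by
    rw [Matrix.trace_mul_comm, mul_assoc]
  have h2 : (A * (Q * S)).trace = (S * (A * Q)).trace := by
    rw [← mul_assoc, Matrix.trace_mul_comm]
  simp only [Matrix.mul_sub, Matrix.trace_sub, h1, h2]

theorem transpose_deriv_eq {f : ℝ → Mat n} {f' : Mat n} {t : ℝ} (h : HasDerivAt f f' t)
    (hs : ∀ᶠ s in 𝓝 t, (f s)ᵀ = f s) : f'ᵀ = f' :=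
  ((HasDerivAt.matrix_transpose h).congr_of_eventuallyEq
    (hs.mono fun _ hs => hs.symm)).unique h

theorem tangent_of_hasDerivAt {f : ℝ → Mat n} {f' : Mat n} {t : ℝ} (h : HasDerivAt f f' t)
    (hs : ∀ᶠ s in 𝓝 t, f s * f s = 1) : f t * f' + f' * f t = 0 := by
  rw [add_comm]
  refine (h.mul h).unique ((hasDerivAt_const t (1 : Mat n)).congr_of_eventuallyEq ?_)
  exact hs

/-! ### Curves in the Grassmannian: the equation implies criticality -/

section Curve

variable {I : Set ℝ} {c : ℝ → Mat n}

theorem curve_transpose (hI : IsOpen I) (hc : ContDiffOn ℝ 2 c I) (hmem : ∀ t ∈ I, c t ∈ Gr k n)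
    {t : ℝ} (ht : t ∈ I) : (deriv (deriv c) t)ᵀ = deriv (deriv c) t := by
  refine transpose_deriv_eq (hasDerivAt_deriv_of_contDiffOn hI hc ht).2 ?_
  filter_upwards [hI.mem_nhds ht] with s hs
  refine transpose_deriv_eq (hasDerivAt_deriv_of_contDiffOn hI hc hs).1 ?_
  filter_upwards [hI.mem_nhds hs] with r hr using Gr.transpose_eq (hmem r hr)

theorem curve_tangent (hI : IsOpen I) (hc : ContDiffOn ℝ 2 c I) (hmem : ∀ t ∈ I, c t ∈ Gr k n)
    {t : ℝ} (ht : t ∈ I) : c t * deriv c t + deriv c t * c t = 0 :=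
  tangent_of_hasDerivAt (hasDerivAt_deriv_of_contDiffOn hI hc ht).1 <| by
    filter_upwards [hI.mem_nhds ht] with s hs using Gr.mul_self (hmem s hs)

theorem curve_second (hI : IsOpen I) (hc : ContDiffOn ℝ 2 c I) (hmem : ∀ t ∈ I, c t ∈ Gr k n)
    {t : ℝ} (ht : t ∈ I) : deriv c t * deriv c t + c t * deriv (deriv c) t +
      (deriv (deriv c) t * c t + deriv c t * deriv c t) = 0 := by
  obtain ⟨h1, h2⟩ := hasDerivAt_deriv_of_contDiffOn hI hc ht
  refine ((h1.mul h2).add (h2.mul h1)).unique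
    ((hasDerivAt_const t (0 : Mat n)).congr_of_eventuallyEq ?_)
  filter_upwards [hI.mem_nhds ht] with s hs using curve_tangent hI hc hmem hs

theorem geodesic_equation_iff (hI : IsOpen I) (hc : ContDiffOn ℝ 2 c I)
    (hmem : ∀ t ∈ I, c t ∈ Gr k n) {t : ℝ} (ht : t ∈ I) :
    (c t)ᵀ * deriv (deriv c) t - (deriv (deriv c) t)ᵀ * c t = 0 ↔
      c t * deriv (deriv c) t = deriv (deriv c) t * c t := by
  rw [Gr.transpose_eq (hmem t ht), curve_transpose hI hc hmem ht, sub_eq_zero]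

theorem IsProperVariation.hasDerivAt {a b δ : ℝ} (hδ : 0 < δ) {F : ℝ → ℝ → Mat n}
    (hF : IsProperVariation k c a b δ F) {t : ℝ} (ht : t ∈ Icc a b) :
    HasDerivAt (fun ε => F ε t) (deriv (fun ε => F ε t) 0) 0 := by
  obtain ⟨D₁, _, _, -, -, h⟩ :=
    exists_partial_derivs_of_contDiffOn (isOpen_Ioo.prod isOpen_Ioo) hF.contDiffOn
  have h1 := (h 0 t ⟨⟨by linarith, hδ⟩, ⟨by linarith [ht.1], by linarith [ht.2]⟩⟩).1
  have h2 : deriv (fun ε => F ε t) 0 = D₁ (0, t) := h1.deriv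
  rw [h2]
  exact h1

theorem isGeodesicOn_of_equation (hI : IsOpen I) (hconn : I.OrdConnected)
    (hc : ContDiffOn ℝ 2 c I) (hmem : ∀ t ∈ I, c t ∈ Gr k n)
    (hode : ∀ t ∈ I, (c t)ᵀ * deriv (deriv c) t - (deriv (deriv c) t)ᵀ * c t = 0) :
    IsGeodesicOn k I c := by
  have hnormal : ∀ t ∈ I, ∀ W, c t * W + W * c t = 0 → metric (deriv (deriv c) t) W = 0 :=
    fun t ht W hW => metric_eq_zero_of_commute (Gr.mul_self (hmem t ht))
      (curve_transpose hI hc hmem ht) ((geodesic_equation_iff hI hc hmem ht).1 (hode t ht)) hW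
  have hspeed : ∃ K : ℝ, ∀ t ∈ I, riemNorm (deriv c t) = K := by
    rcases I.eq_empty_or_nonempty with rfl | ⟨s, hs⟩
    · exact ⟨0, fun t ht => ht.elim⟩
    · have hd : ∀ t ∈ I, HasDerivAt (fun t => metric (deriv c t) (deriv c t)) 0 t := fun t ht => by
        have h2 := (hasDerivAt_deriv_of_contDiffOn hI hc ht).2
        refine (HasDerivAt.metric h2 h2).congr_deriv ?_
        rw [metric_comm (deriv c t), hnormal t ht _ (curve_tangent hI hc hmem ht), add_zero]
      refine ⟨riemNorm (deriv c s), fun t ht => congrArg Real.sqrt ?_⟩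
      exact hI.is_const_of_deriv_eq_zero hconn.isPreconnected
        (fun t ht => (hd t ht).differentiableAt.differentiableWithinAt)
        (fun t ht => (hd t ht).deriv) ht hs
  obtain ⟨K, hK⟩ := hspeed
  refine ⟨hc, hmem, K, hK, fun hK0 a b hab hsub δ hδ F hF => ?_⟩
  refine (hF.hasDerivAt_curveLength hI hc hK0 hK hab hsub hδ).congr_deriv ?_
  rw [intervalIntegral.integral_congr (g := fun _ => (0 : ℝ))]
  · simp
  · intro t ht
    rw [uIcc_of_le hab.le] at ht
    refine hnormal t (hsub ht) _ ?_
    -- For fixed `t`, `ε ↦ F ε t` consists of involutions, so its velocity at `0` is tangent at `c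
    -- t`.
    have h := tangent_of_hasDerivAt (hF.hasDerivAt hδ ht) <| by
      filter_upwards [Ioo_mem_nhds (neg_lt_zero.2 hδ) hδ] with ε hε
        using Gr.mul_self (hF.mem ε hε t ht)
    rwa [hF.zero t ht] at h

end Curve

/-! ### Rotations, necessity of the equation, and uniqueness -/

theorem exp_mul_exp_neg (S : Mat n) : NormedSpace.exp S * NormedSpace.exp (-S) = 1 := by
  rw [← Matrix.exp_add_of_commute _ _ (Commute.refl S).neg_right, add_neg_cancel,
    NormedSpace.exp_zero]

theorem exp_transpose_of_skew {S : Mat n} (hS : Sᵀ = -S) :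
    (NormedSpace.exp S)ᵀ = NormedSpace.exp (-S) := by
  rw [← Matrix.exp_transpose, hS]

theorem contDiff_exp {m : WithTop ℕ∞} : ContDiff ℝ m (NormedSpace.exp : Mat n → Mat n) :=
  contDiff_iff_contDiffAt.2 fun x => (NormedSpace.exp_analytic (𝕂 := ℝ) x).contDiffAt

theorem hasDerivAt_exp_smul (S : Mat n) (t : ℝ) :
    HasDerivAt (fun u : ℝ => NormedSpace.exp (u • S)) (NormedSpace.exp (t • S) * S) t :=
  hasDerivAt_exp_smul_const S t

theorem hasDerivAt_exp_smul' (S : Mat n) (t : ℝ) :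
    HasDerivAt (fun u : ℝ => NormedSpace.exp (u • S)) (S * NormedSpace.exp (t • S)) t :=
  hasDerivAt_exp_smul_const' S t

theorem Gr.conj_exp {S Q : Mat n} (hS : Sᵀ = -S) (hQ : Q ∈ Gr k n) :
    NormedSpace.exp S * Q * NormedSpace.exp (-S) ∈ Gr k n := by
  rw [← exp_transpose_of_skew hS]
  refine Gr.conj ?_ hQ
  rw [exp_transpose_of_skew hS, mul_eq_one_comm, exp_mul_exp_neg]

/-- The variation of a curve by a one-parameter group of rotations. -/
theorem isProperVariation_rotation {I : Set ℝ} {c : ℝ → Mat n}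
    (hc : ContDiffOn ℝ 2 c I) (hmem : ∀ t ∈ I, c t ∈ Gr k n) {S : Mat n} (hS : Sᵀ = -S)
    {φ : ℝ → ℝ} (hφ : ContDiff ℝ 2 φ) {a b δ : ℝ} (hδ : 0 < δ) (hsub : Ioo (a - δ) (b + δ) ⊆ I)
    (ha : φ a = 0) (hb : φ b = 0) :
    IsProperVariation k c a b δ fun ε t =>
      NormedSpace.exp ((ε * φ t) • S) * c t * NormedSpace.exp (-((ε * φ t) • S)) where
  contDiffOn := by
    have h1 : ContDiff ℝ 2 fun p : ℝ × ℝ => (p.1 * φ p.2) • S :=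
      (contDiff_fst.mul (hφ.comp contDiff_snd)).smul contDiff_const
    refine ((contDiff_exp.comp h1).contDiffOn.mul ?_).mul (contDiff_exp.comp h1.neg).contDiffOn
    exact hc.comp contDiff_snd.contDiffOn fun p hp => hsub hp.2
  mem := fun ε _ t ht => by
    refine Gr.conj_exp ?_ (hmem t (hsub ⟨by linarith [ht.1], by linarith [ht.2]⟩))
    rw [Matrix.transpose_smul, hS, smul_neg]
  zero := by simp
  left := by simp [ha]
  right := by simp [hb]

theorem hasDerivAt_rotation (S C : Mat n) (r : ℝ) :
    HasDerivAt (fun ε : ℝ => NormedSpace.exp ((ε * r) • S) * C * NormedSpace.exp (-((ε * r) • S)))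
      (r • (S * C - C * S)) 0 := by
  have h1 := hasDerivAt_exp_smul (r • S) 0
  have h2 := hasDerivAt_exp_smul (-(r • S)) 0
  have h := (h1.mul_const C).mul h2
  simp only [zero_smul, NormedSpace.exp_zero, one_mul, mul_one] at h
  refine (h.congr_of_eventuallyEq (Eventually.of_forall fun ε => ?_)).congr_deriv ?_
  · simp only [mul_smul, smul_neg, Pi.mul_apply]
  · rw [smul_mul_assoc, mul_neg, mul_smul_comm]
    exact (sub_eq_add_neg _ _).symm.trans (smul_sub r _ _).symm

/-- The fundamental lemma of the calculus of variations, with a single test variation: were `[c,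
c̈]` nonzero at `t₀`, rotating in its own direction near `t₀` would change the length to first
order. -/
theorem equation_of_isGeodesicOn {I : Set ℝ} {c : ℝ → Mat n} (hI : IsOpen I)
    (h : IsGeodesicOn k I c) {t₀ : ℝ} (ht₀ : t₀ ∈ I) :
    (c t₀)ᵀ * deriv (deriv c) t₀ - (deriv (deriv c) t₀)ᵀ * c t₀ = 0 := by
  have hc := h.contDiffOn
  have hmem := h.mem
  obtain ⟨K, hK, hcrit⟩ := h.constSpeed_critical
  rw [geodesic_equation_iff hI hc hmem ht₀, ← sub_eq_zero]
  -- Criticality says nothing at speed zero, but then `ċ` vanishes near `t₀`, hence so does `c̈`.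
  by_cases hK0 : K = 0
  · have h0 : deriv (deriv c) t₀ = 0 := by
      refine (hasDerivAt_deriv_of_contDiffOn hI hc ht₀).2.unique
        ((hasDerivAt_const t₀ (0 : Mat n)).congr_of_eventuallyEq ?_)
      filter_upwards [hI.mem_nhds ht₀] with s hs
      exact riemNorm_eq_zero.1 ((hK s hs).trans hK0)
    simp [h0]
  by_contra hne
  set A : ℝ → Mat n := fun t => c t * deriv (deriv c) t - deriv (deriv c) t * c t with hA
  have hAc : ContinuousOn A I :=
    (hc.continuousOn.mul (continuousOn_deriv_deriv hI hc)).sub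
      ((continuousOn_deriv_deriv hI hc).mul hc.continuousOn)
  have hfc : ContinuousOn (fun t => metric (A t₀) (A t)) I :=
    ContinuousOn.metric continuousOn_const hAc
  have hpos : 0 < metric (A t₀) (A t₀) :=
    lt_of_le_of_ne (metric_self_nonneg _) fun h0 => hne (metric_self_eq_zero.1 h0.symm)
  -- The generator is `S = (A t₀)ᵀ`, so that `tr(S A(t))` is the metric pairing of `A t₀` with `A
  -- t`, positive near `t₀`.
  have hskew : (A t₀)ᵀᵀ = -(A t₀)ᵀ := by
    simp [hA, Matrix.transpose_sub, Matrix.transpose_mul, Gr.transpose_eq (hmem t₀ ht₀),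
      curve_transpose hI hc hmem ht₀]
  obtain ⟨r, hr, hball⟩ := Metric.isOpen_iff.1
    (hfc.isOpen_inter_preimage hI isOpen_Ioi) t₀ ⟨ht₀, hpos⟩
  rw [Real.ball_eq_Ioo] at hball
  -- Half the radius leaves a margin `δ = r / 2` on each side, as a variation must be `C²` beyond
  -- `[a, b]`.
  set a := t₀ - r / 2 with ha
  set b := t₀ + r / 2 with hb
  have hab : a < b := by linarith
  have hIoo : Ioo (a - r / 2) (b + r / 2) ⊆ I := fun t ht =>
    (hball ⟨by linarith [ht.1], by linarith [ht.2]⟩).1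
  have hIcc : Icc a b ⊆ Ioo (t₀ - r) (t₀ + r) := fun t ht =>
    ⟨by linarith [ht.1], by linarith [ht.2]⟩
  have hIccI : Icc a b ⊆ I := fun t ht => (hball (hIcc ht)).1
  -- Only vanishing at the end points and positivity between them are needed, so a quadratic serves
  -- as the cutoff.
  set φ : ℝ → ℝ := fun t => (t - a) * (b - t) with hφ
  have hφc : ContDiff ℝ 2 φ := (contDiff_id.sub contDiff_const).mul (contDiff_const.sub contDiff_id)
  have hvar := isProperVariation_rotation hc hmem hskew hφc (half_pos hr) hIoo
    (by simp [hφ]) (by simp [hφ])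
  have hzero := (hvar.hasDerivAt_curveLength hI hc hK0 hK hab hIccI (half_pos hr)).unique
    (hcrit hK0 a b hab hIccI _ (half_pos hr) _ hvar)
  have hint : ∀ t ∈ Icc a b, metric (deriv (deriv c) t) (deriv (fun ε : ℝ =>
      NormedSpace.exp ((ε * φ t) • (A t₀)ᵀ) * c t * NormedSpace.exp (-((ε * φ t) • (A t₀)ᵀ))) 0) =
      φ t * metric (A t₀) (A t) := fun t ht => by
    have hd : deriv (fun ε : ℝ => NormedSpace.exp ((ε * φ t) • (A t₀)ᵀ) * c t *
      NormedSpace.exp (-((ε * φ t) • (A t₀)ᵀ))) 0 = _ :=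
      (hasDerivAt_rotation (A t₀)ᵀ (c t) (φ t)).deriv
    rw [hd, metric, curve_transpose hI hc hmem (hIccI ht), mul_smul_comm, Matrix.trace_smul,
      smul_eq_mul, trace_mul_commutator, metric]
  rw [intervalIntegral.integral_congr (g := fun t => φ t * metric (A t₀) (A t))
    (fun t ht => hint t (by rwa [uIcc_of_le hab.le] at ht))] at hzero
  have hgt : 0 < ∫ t in a..b, φ t * metric (A t₀) (A t) := by
    refine intervalIntegral.intervalIntegral_pos_of_pos_on ?_ (fun t ht => ?_) hab
    · refine ContinuousOn.intervalIntegrable ?_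
      rw [uIcc_of_le hab.le]
      exact hφc.continuous.continuousOn.mul (hfc.mono hIccI)
    · exact mul_pos (mul_pos (by linarith [ht.1]) (by linarith [ht.2]))
        (hball (hIcc (Ioo_subset_Icc_self ht))).2
  rcases mul_eq_zero.1 hzero with h0 | h0
  · exact hK0 (inv_eq_zero.1 (neg_eq_zero.1 h0))
  · exact hgt.ne' h0

/-- Solutions of `ċ = c M` on an interval are determined by their initial value. -/
theorem eqOn_of_hasDerivAt_mul {I : Set ℝ} (hI : IsOpen I) (hconn : I.OrdConnected)
    (h0 : (0 : ℝ) ∈ I) {c γ : ℝ → Mat n} {M : Mat n} (hc : ∀ t ∈ I, HasDerivAt c (c t * M) t)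
    (hγ : ∀ t ∈ I, HasDerivAt γ (γ t * M) t) (hinit : c 0 = γ 0) : EqOn c γ I := by
  -- The integrating factor `exp(-tM)` makes every solution constant.
  have key : ∀ f : ℝ → Mat n, (∀ t ∈ I, HasDerivAt f (f t * M) t) →
      ∀ t ∈ I, f t * NormedSpace.exp (t • -M) = f 0 := fun f hf t ht => by
    have hd : ∀ s ∈ I, HasDerivAt (fun s => f s * NormedSpace.exp (s • -M)) 0 s := fun s hs => by
      refine ((hf s hs).mul (hasDerivAt_exp_smul' (-M) s)).congr_deriv ?_
      noncomm_ring
    have h := hI.is_const_of_deriv_eq_zero hconn.isPreconnected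
      (fun s hs => (hd s hs).differentiableAt.differentiableWithinAt)
      (fun s hs => (hd s hs).deriv) ht h0
    simpa using h
  intro t ht
  have h1 : c t * NormedSpace.exp (t • -M) = γ t * NormedSpace.exp (t • -M) := by
    rw [key c hc t ht, key γ hγ t ht, hinit]
  have h2 := congrArg (· * NormedSpace.exp (-(t • -M))) h1
  simpa only [mul_assoc, exp_mul_exp_neg, mul_one] using h2

/-- A geodesic satisfies a linear differential equation of first order. -/
theorem IsGeodesicOn.hasDerivAt_mul {I : Set ℝ} {c : ℝ → Mat n} (hI : IsOpen I)
    (hconn : I.OrdConnected) (h0 : (0 : ℝ) ∈ I) (h : IsGeodesicOn k I c) {X : Mat n}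
    (hX : HasDerivAt c X 0) : ∀ t ∈ I, HasDerivAt c (c t * (c 0 * X)) t := by
  have hc := h.contDiffOn
  have hmem := h.mem
  have hd : ∀ t ∈ I, HasDerivAt (fun t => c t * deriv c t) 0 t := fun t ht => by
    obtain ⟨h1, h2⟩ := hasDerivAt_deriv_of_contDiffOn hI hc ht
    refine (h1.mul h2).congr_deriv ?_
    have h3 := curve_second hI hc hmem ht
    -- As `c̈` commutes with `c`, the second derivative of `c² = 1` reads `2 (ċ² + c c̈) = 0`.
    rw [← (geodesic_equation_iff hI hc hmem ht).1 (equation_of_isGeodesicOn hI h ht),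
      add_comm (c t * _) (deriv c t * deriv c t), ← two_smul ℝ] at h3
    exact (smul_eq_zero.1 h3).resolve_left two_ne_zero
  intro t ht
  have hconst : c t * deriv c t = c 0 * deriv c 0 :=
    hI.is_const_of_deriv_eq_zero hconn.isPreconnected
      (fun s hs => (hd s hs).differentiableAt.differentiableWithinAt)
      (fun s hs => (hd s hs).deriv) ht h0
  have hX' : deriv c 0 = X := hX.deriv
  refine (hasDerivAt_deriv_of_contDiffOn hI hc ht).1.congr_deriv ?_
  rw [← hX', ← hconst, ← mul_assoc, Gr.mul_self (hmem t ht)]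
  exact (one_mul _).symm

/-! ### Block matrices and the signature matrix -/

section Block

variable (hk : k ≤ n)

theorem block_mul (A A' : Matrix (Fin k) (Fin k) ℝ) (B B' : Matrix (Fin k) (Fin (n - k)) ℝ)
    (C C' : Matrix (Fin (n - k)) (Fin k) ℝ) (D D' : Matrix (Fin (n - k)) (Fin (n - k)) ℝ) :
    block hk A B C D * block hk A' B' C' D' =
      block hk (A * A' + B * C') (A * B' + B * D') (C * A' + D * C') (C * B' + D * D') := by
  simp only [block, Matrix.reindex_apply, Matrix.submatrix_mul_equiv, Matrix.fromBlocks_multiply]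

theorem block_neg (A : Matrix (Fin k) (Fin k) ℝ) (B : Matrix (Fin k) (Fin (n - k)) ℝ)
    (C : Matrix (Fin (n - k)) (Fin k) ℝ) (D : Matrix (Fin (n - k)) (Fin (n - k)) ℝ) :
    -block hk A B C D = block hk (-A) (-B) (-C) (-D) := by
  simp only [block, ← Matrix.fromBlocks_neg]
  rfl

theorem block_transpose (A : Matrix (Fin k) (Fin k) ℝ) (B : Matrix (Fin k) (Fin (n - k)) ℝ)
    (C : Matrix (Fin (n - k)) (Fin k) ℝ) (D : Matrix (Fin (n - k)) (Fin (n - k)) ℝ) :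
    (block hk A B C D)ᵀ = block hk Aᵀ Cᵀ Bᵀ Dᵀ := by
  simp only [block, Matrix.transpose_reindex, Matrix.fromBlocks_transpose]

theorem block_one : block hk 1 0 0 1 = 1 := by
  simp only [block, Matrix.fromBlocks_one, Matrix.reindex_apply, Matrix.submatrix_one_equiv]

theorem signature_mem : signature hk ∈ Gr k n := by
  refine Gr.of_mul_self ?_ ?_ ?_
  · simp [signature, block_mul, block_one]
  · simp [signature, block_transpose]
  · simp only [signature, block, Matrix.trace, Matrix.diag, Matrix.reindex_apply,
      Matrix.submatrix_apply]
    rw [Equiv.sum_comp (finSumFinEquiv.trans (finCongr (Nat.add_sub_of_le hk))).symm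
      (fun i => Matrix.fromBlocks 1 0 0 (-1) i i), Fintype.sum_sum_type]
    simp [Nat.cast_sub hk]
    ring

end Block

/-! ### The explicit curve and its differential equations -/

section GeodesicCurve

variable (hk : k ≤ n) {V : Mat n} (B : Matrix (Fin k) (Fin (n - k)) ℝ)

theorem geodesicCurve_eq (t : ℝ) : geodesicCurve hk V B t =
    V * (NormedSpace.exp ((t / 2) • block hk 0 (-B) Bᵀ 0) * signature hk *
      NormedSpace.exp (-((t / 2) • block hk 0 (-B) Bᵀ 0))) * Vᵀ := by
  have h : block hk 0 B (-Bᵀ) 0 = -block hk 0 (-B) Bᵀ 0 := by simp [block_neg]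
  rw [geodesicCurve, h, smul_neg]
  simp only [mul_assoc]

theorem geodesicCurve_mem (hV : Vᵀ * V = 1) (t : ℝ) : geodesicCurve hk V B t ∈ Gr k n := by
  rw [geodesicCurve_eq]
  refine Gr.conj hV (Gr.conj_exp ?_ (signature_mem hk))
  rw [Matrix.transpose_smul, block_transpose, ← smul_neg, block_neg]
  simp

theorem contDiff_geodesicCurve {m : WithTop ℕ∞} : ContDiff ℝ m (geodesicCurve hk V B) := by
  have h : ∀ S : Mat n, ContDiff ℝ m fun t : ℝ => NormedSpace.exp ((t / 2) • S) := fun S =>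
    contDiff_exp.comp ((contDiff_id.div_const 2).smul contDiff_const)
  exact (((contDiff_const.mul (h _)).mul contDiff_const).mul (h _)).mul contDiff_const

theorem geodesicCurve_zero : geodesicCurve hk V B 0 = V * signature hk * Vᵀ := by
  simp [geodesicCurve]

theorem hasDerivAt_geodesicCurve (hV : Vᵀ * V = 1) (t : ℝ) :
    HasDerivAt (geodesicCurve hk V B)
      (geodesicCurve hk V B t * (V * block hk 0 B (-Bᵀ) 0 * Vᵀ)) t := by
  set N := (1 / 2 : ℝ) • block hk 0 (-B) Bᵀ 0 with hN
  set P := (1 / 2 : ℝ) • block hk 0 B (-Bᵀ) 0 with hP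
  set J := signature hk with hJ
  -- The signature matrix intertwines the two generators, so the left factor contributes the same
  -- derivative as the right one; the two halves add up to the full generator.
  have hJN : N * J = J * P := by simp [hN, hP, hJ, signature, block_mul]
  have hPP : block hk 0 B (-Bᵀ) 0 = P + P := by
    rw [hP, ← add_smul]
    norm_num
  have hγ : geodesicCurve hk V B =
      fun s => V * NormedSpace.exp (s • N) * J * NormedSpace.exp (s • P) * Vᵀ := by
    funext s
    rw [geodesicCurve, hN, hP, smul_smul, smul_smul, mul_one_div]
  have hcomm : P * NormedSpace.exp (t • P) = NormedSpace.exp (t • P) * P :=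
    (hasDerivAt_exp_smul' P t).unique (hasDerivAt_exp_smul P t)
  rw [hγ, hPP]
  refine (((((hasDerivAt_exp_smul N t).const_mul V).mul_const J).mul
    (hasDerivAt_exp_smul' P t)).mul_const Vᵀ).congr_deriv ?_
  have hleft : V * (NormedSpace.exp (t • N) * N) * J = V * NormedSpace.exp (t • N) * J * P := by
    simp only [mul_assoc, hJN]
  rw [hleft, mul_assoc _ P, ← mul_add, hcomm, ← mul_add]
  calc _ = V * NormedSpace.exp (t • N) * J * NormedSpace.exp (t • P) * (P + P) * Vᵀ := by
        simp only [mul_assoc]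
    _ = V * NormedSpace.exp (t • N) * J * NormedSpace.exp (t • P) * (Vᵀ * V) * (P + P) * Vᵀ := by
        rw [hV, mul_one]
    _ = _ := by simp only [mul_assoc]

theorem geodesicCurve_equation (hV : Vᵀ * V = 1) (t : ℝ) :
    (geodesicCurve hk V B t)ᵀ * deriv (deriv (geodesicCurve hk V B)) t -
      (deriv (deriv (geodesicCurve hk V B)) t)ᵀ * geodesicCurve hk V B t = 0 := by
  have hder := hasDerivAt_geodesicCurve hk B hV
  have hM : (V * block hk 0 B (-Bᵀ) 0 * Vᵀ)ᵀ = -(V * block hk 0 B (-Bᵀ) 0 * Vᵀ) := by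
    have h : block hk 0 (-B) Bᵀ 0 = -block hk 0 B (-Bᵀ) 0 := by simp [block_neg]
    simp [Matrix.transpose_mul, block_transpose, mul_assoc, h]
  set M := V * block hk 0 B (-Bᵀ) 0 * Vᵀ
  have hmem := geodesicCurve_mem hk B hV t
  set γ := geodesicCurve hk V B
  have h1 : deriv γ = fun s => γ s * M := funext fun s => (hder s).deriv
  -- With `γ² = 1` and `M` skew, both `γᵀγ̈` and `γ̈ᵀγ` reduce to `M²`.
  have h2 : deriv (deriv γ) t = γ t * M * M := by
    rw [h1]
    exact ((hder t).mul_const M).deriv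
  rw [h2, Gr.transpose_eq hmem, Matrix.transpose_mul _ M, Matrix.transpose_mul _ M,
    Gr.transpose_eq hmem, hM]
  simp only [mul_assoc, neg_mul, mul_neg, neg_neg]
  rw [← mul_assoc (γ t) (γ t), Gr.mul_self hmem, one_mul, mul_one, sub_self]

end GeodesicCurve

end Involution

theorem theorem4p3 (k n : ℕ) (hk : k ≤ n)
    (V : Involution.Mat n) (hV : V ∈ Matrix.orthogonalGroup (Fin n) ℝ)
    (B : Matrix (Fin k) (Fin (n - k)) ℝ)
    (Q X : Involution.Mat n)
    (hQ : Q = V * Involution.signature hk * Vᵀ)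
    (hX : X = V * Involution.block hk 0 B Bᵀ 0 * Vᵀ) :
    -- `γ` is a smooth geodesic, defined for all times, with `γ(0) = Q` and `γ'(0) = X`
    (ContDiff ℝ ∞ (Involution.geodesicCurve hk V B) ∧
      Involution.IsGeodesicOn k univ (Involution.geodesicCurve hk V B) ∧
      Involution.geodesicCurve hk V B 0 = Q ∧
      HasDerivAt (Involution.geodesicCurve hk V B) X 0) ∧
    -- it is the only one
    (∀ (I : Set ℝ) (c : ℝ → Involution.Mat n), IsOpen I → I.OrdConnected → (0 : ℝ) ∈ I →
      Involution.IsGeodesicOn k I c → c 0 = Q → HasDerivAt c X 0 →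
        EqOn c (Involution.geodesicCurve hk V B) I) ∧
    -- `γ` satisfies the differential equation
    (∀ t : ℝ,
      (Involution.geodesicCurve hk V B t)ᵀ * deriv (deriv (Involution.geodesicCurve hk V B)) t -
        (deriv (deriv (Involution.geodesicCurve hk V B)) t)ᵀ *
          Involution.geodesicCurve hk V B t = 0) ∧
    -- and the equation characterizes the geodesic among the curves in the Grassmannian
    -- with these initial values
    (∀ (I : Set ℝ) (c : ℝ → Involution.Mat n), IsOpen I → I.OrdConnected → (0 : ℝ) ∈ I →
      ContDiffOn ℝ 2 c I → (∀ t ∈ I, c t ∈ Involution.Gr k n) → c 0 = Q → HasDerivAt c X 0 →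
        (Involution.IsGeodesicOn k I c ↔
          ∀ t ∈ I, (c t)ᵀ * deriv (deriv c) t - (deriv (deriv c) t)ᵀ * c t = 0)) := by
  have hV' : Vᵀ * V = 1 := (Matrix.mem_orthogonalGroup_iff' (Fin n) ℝ).1 hV
  have hder := Involution.hasDerivAt_geodesicCurve hk B hV'
  have hγ0 : Involution.geodesicCurve hk V B 0 = Q :=
    (Involution.geodesicCurve_zero hk B).trans hQ.symm
  have hmem := Involution.geodesicCurve_mem hk B hV'
  have hQQ : Q * Q = 1 := hγ0 ▸ Involution.Gr.mul_self (hmem 0)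
  -- This identifies the generator of the explicit curve with the matrix `QX` governing every
  -- geodesic with these initial values.
  have hQX : Q * X = V * Involution.block hk 0 B (-Bᵀ) 0 * Vᵀ := by
    have hblock : Involution.signature hk * Involution.block hk 0 B Bᵀ 0 =
        Involution.block hk 0 B (-Bᵀ) 0 := by
      simp [Involution.signature, Involution.block_mul]
    calc Q * X = V * Involution.signature hk * (Vᵀ * V) * Involution.block hk 0 B Bᵀ 0 * Vᵀ := by
          rw [hQ, hX]
          simp only [mul_assoc]
      _ = _ := by rw [hV', mul_one, mul_assoc V, hblock]
  rw [← hQX] at hder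
  have hode := Involution.geodesicCurve_equation hk B hV'
  refine ⟨⟨Involution.contDiff_geodesicCurve hk B, ?_, hγ0, ?_⟩, ?_, hode, ?_⟩
  · exact Involution.isGeodesicOn_of_equation isOpen_univ ordConnected_univ
      (Involution.contDiff_geodesicCurve hk B).contDiffOn (fun t _ => hmem t) fun t _ => hode t
  · refine (hder 0).congr_deriv ?_
    rw [hγ0, ← mul_assoc, hQQ, one_mul]
  · intro I c hI hconn h0 hgeo hc0 hcX
    refine Involution.eqOn_of_hasDerivAt_mul hI hconn h0 (M := Q * X) ?_ (fun t _ => hder t)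
      (hc0.trans hγ0.symm)
    have h := hgeo.hasDerivAt_mul hI hconn h0 hcX
    rwa [hc0] at h
  · intro I c hI hconn _ hc hcmem _ _
    exact ⟨fun hgeo t ht => Involution.equation_of_isGeodesicOn hI hgeo ht,
      Involution.isGeodesicOn_of_equation hI hconn hc hcmem⟩
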